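/- Let $M$ be a non-empty oriented smooth manifold of even dimension $2m\ge 4$, and let $g$ and $\widetilde g$ be two Riemannian metrics on $M$. Let $\mathcal Z$ be the (positive) twistor space of $(M,g)$, i.e. the bundle over $M$ whose fibre over $p\in M$ consists of the $g$-orthogonal complex structures $J$ on $T_pM$ which induce the given orientation; it is a submanifold of the total space of $\mathrm{Hom}(TM,TM)$. The Levi-Civita connection of $g$ gives the splitting $T_J\mathcal Z=\mathcal H_J\oplus\mathcal V_J$ into the horizontal space and the vertical space $$\mathcal V_J=\{U\in \mathrm{End}(T_pM): U \text{ is } g\text{-skew-symmetric},\ UJ=-JU\},$$ where $p$ is the base point of $J$. Denote by $X^h_J\in\mathcal H_J$ the horizontal lift of $X\in T_pM$. The Atiyah–Hitchin–Singer and the Eells–Salamon almost complex structures on $\mathcal Z$ are, respectively, $$\mathcal J_1(X^h_J+U)=(JX)^h_J+J\circ U,\qquad \mathcal J_2(X^h_J+U)=(JX)^h_J-J\circ U .$$ Let $\widetilde{\mathcal Z}$, $\widetilde{\mathcal J}_1$, $\widetilde{\mathcal J}_2$ be the corresponding objects for $\widetilde g$ and the same orientation. Let $C$ be the endomorphism of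 $TM$ with $g(CX,Y)=\widetilde g(X,Y)$, let $Q$ be its principal square root (the $g$-symmetric positive definite endomorphism with $Q^2=C$), and let $\Psi:\mathcal Z\to\widetilde{\mathcal Z}$ be the smooth map $\Psi(J)=Q^{-1}JQ$. A smooth map $\varphi:(N,\mathcal J)\to(\widetilde N,\widetilde{\mathcal J})$ of almost complex manifolds is called holomorphic if $\widetilde{\mathcal J}\circ\varphi_*=\varphi_*\circ \mathcal J$, and anti-holomorphic if $\widetilde{\mathcal J}\circ\varphi_*=-\varphi_*\circ \mathcal J$. Then the map $\Psi:(\mathcal Z,\mathcal J_1)\to(\widetilde{\mathcal Z},\widetilde{\mathcal J}_2)$ is neither holomorphic nor anti-holomorphic, and the map $\Psi:(\mathcal Z,\mathcal J_2)\to(\widetilde{\mathcal Z},\widetilde{\mathcal J}_1)$ is neither holomorphic nor anti-holomorphic. -/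

import Mathlib

open scoped Manifold
open scoped ContDiff Topology

noncomputable section

namespace Twistor

/-! ### Linear algebra -/

/-- Every self-adjoint positive definite endomorphism `C` of a finite dimensional Euclidean space
`(V, b)` has a self-adjoint positive definite square root. -/
theorem exists_sqrt {V : Type*} [AddCommGroup V] [Module ℝ V] [FiniteDimensional ℝ V]
    (b : V →ₗ[ℝ] V →ₗ[ℝ] ℝ) (symm : ∀ x y, b x y = b y x) (pos : ∀ x, x ≠ 0 → 0 < b x x)
    (C : V →ₗ[ℝ] V) (hC : ∀ x y, b (C x) y = b x (C y)) (hC' : ∀ x, x ≠ 0 → 0 < b (C x) x) :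
    ∃ Q : V →ₗ[ℝ] V, (∀ x y, b (Q x) y = b x (Q y)) ∧ (∀ x, x ≠ 0 → 0 < b (Q x) x) ∧
      ∀ x, Q (Q x) = C x := by
  let core : InnerProductSpace.Core ℝ V :=
    { inner := fun x y => b x y
      conj_inner_symm := fun x y => by simpa using symm y x
      re_inner_nonneg := fun x => by
        rcases eq_or_ne x 0 with rfl | h
        · simp
        · simpa using (pos x h).le
      add_left := fun x y z => by simp
      smul_left := fun x y r => by simp
      definite := fun x h => by
        by_contra h'
        exact (pos x h').ne' h }
  let _ : NormedAddCommGroup V := core.toNormedAddCommGroup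
  let _ : InnerProductSpace ℝ V := InnerProductSpace.ofCore core.toCore
  have hinner : ∀ x y : V, inner ℝ x y = b x y := fun _ _ => rfl
  have hsymm : C.IsSymmetric := fun x y => hC x y
  let e := hsymm.eigenvectorBasis rfl
  let l := hsymm.eigenvalues rfl
  have hl : ∀ i, 0 < l i := fun i => by
    have h1 : C (e i) = l i • e i := hsymm.apply_eigenvectorBasis rfl i
    have h0 : e i ≠ 0 := e.orthonormal.ne_zero i
    have h2 := hC' (e i) h0
    rw [h1, map_smul, LinearMap.smul_apply, smul_eq_mul] at h2
    exact pos_of_mul_pos_left h2 (pos _ h0).le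
  let Q : V →ₗ[ℝ] V := e.toBasis.constr ℝ fun i => Real.sqrt (l i) • e i
  have hQ : ∀ i, Q (e i) = Real.sqrt (l i) • e i := fun i => by
    have h := e.toBasis.constr_basis ℝ (fun i => Real.sqrt (l i) • e i) i
    rwa [OrthonormalBasis.coe_toBasis] at h
  have hrepr : ∀ x i, inner ℝ (e i) (Q x) = Real.sqrt (l i) * inner ℝ (e i) x := by
    intro x i
    conv_lhs => rw [← e.sum_repr x]
    simp only [map_sum, map_smul, hQ, inner_sum, inner_smul_right, e.inner_eq_ite]
    simp [e.repr_apply_apply, mul_comm]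
  refine ⟨Q, fun x y => ?_, fun x hx => ?_, fun x => ?_⟩
  · rw [← hinner, ← hinner, ← e.sum_inner_mul_inner, ← e.sum_inner_mul_inner]
    refine Finset.sum_congr rfl fun i _ => ?_
    rw [real_inner_comm, hrepr, hrepr, real_inner_comm]
    ring
  · rw [← hinner, ← e.sum_inner_mul_inner]
    have hx' : ∃ i, inner ℝ (e i) x ≠ 0 := by
      by_contra! h
      exact hx (e.toBasis.ext_elem_iff.2 fun i => by simp [e.repr_apply_apply, h])
    obtain ⟨i, hi⟩ := hx'
    refine Finset.sum_pos' (fun j _ => ?_) ⟨i, Finset.mem_univ i, ?_⟩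
    · rw [real_inner_comm, hrepr, mul_assoc]
      exact mul_nonneg (Real.sqrt_nonneg _) (mul_self_nonneg _)
    · rw [real_inner_comm, hrepr, mul_assoc]
      exact mul_pos (Real.sqrt_pos.2 (hl i)) (mul_self_pos.2 hi)
  · have : Q ∘ₗ Q = C := e.toBasis.ext fun i => by
      have h1 : C (e i) = l i • e i := hsymm.apply_eigenvectorBasis rfl i
      simp only [OrthonormalBasis.coe_toBasis, LinearMap.comp_apply, hQ, map_smul, h1, smul_smul,
        Real.mul_self_sqrt (hl i).le]
    exact congrArg (fun f : V →ₗ[ℝ] V => f x) this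

/-- For a trilinear form `D`, the bilinear form `D(X, Y, Z) + D(Y, X, Z) - D(Z, X, Y)` in `Y`, `Z`.
-/
def koszulForm {F : Type*} [NormedAddCommGroup F] [NormedSpace ℝ F]
    (D : F →L[ℝ] F →L[ℝ] F →L[ℝ] ℝ) (X : F) : F →ₗ[ℝ] Module.Dual ℝ F :=
  LinearMap.mk₂ ℝ
    (fun Y Z => D X Y Z + D Y X Z - D Z X Y)
    (fun Y Y' Z => by rw [map_add, map_add, map_add]; simp only [add_apply]; ring)
    (fun c Y Z => by
      rw [map_smul, map_smul, map_smul]; simp only [smul_apply, smul_eq_mul]; ring)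
    (fun Y Z Z' => by rw [map_add, map_add, map_add]; simp only [add_apply]; ring)
    (fun c Y Z => by
      rw [map_smul, map_smul, map_smul]; simp only [smul_apply, smul_eq_mul]; ring)

/-- For a metric `G` on an open subset of a normed space, the bilinear form
`X(G(Y, Z)) + Y(G(X, Z)) - Z(G(X, Y))` at the point `y`, where `X`, `Y`, `Z` are constant vector
fields. -/
def koszul {F : Type*} [NormedAddCommGroup F] [NormedSpace ℝ F] (G : F → F →L[ℝ] F →L[ℝ] ℝ)
    (y X : F) : F →ₗ[ℝ] Module.Dual ℝ F :=
  koszulForm (fderiv ℝ G y) X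

section Manifold

/-- The model space of `2m`-dimensional manifolds. -/
abbrev Model (m : ℕ) : Type := EuclideanSpace ℝ (Fin (2 * m))

variable {m : ℕ} {M : Type*} [TopologicalSpace M]
  [ChartedSpace (Model m) M] [IsManifold (𝓡 (2 * m)) ∞ M]

variable (m M) in
/-- Smooth Riemannian metrics on the `2m`-dimensional manifold `M`. -/
abbrev Metric : Type _ :=
  Bundle.ContMDiffRiemannianMetric (𝓡 (2 * m)) ∞ (Model m)
    (fun p : M => TangentSpace (𝓡 (2 * m)) p)

variable (m M) in
/-- The total space of the vector bundle `Hom(TM, TM)`, with its smooth structure from Mathlib.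
Its points are pairs `J = ⟨p, J.2⟩` of a point `p` and an endomorphism `J.2` of `T_pM`. -/
abbrev EndBundle : Type _ :=
  Bundle.TotalSpace (Model m →L[ℝ] Model m)
    (fun p : M => TangentSpace (𝓡 (2 * m)) p →L[ℝ] TangentSpace (𝓡 (2 * m)) p)

variable (m) in
/-- The model with corners of the smooth manifold `EndBundle m M`. -/
abbrev endModel :=
  (𝓡 (2 * m)).prod
    𝓘(ℝ, Model m →L[ℝ] Model m)

/-- The tangent space of `M` at `p`. Mathlib identifies it with the model space, through the
preferred chart of `M` at `p`. -/
abbrev T (m : ℕ) {M : Type*} [TopologicalSpace M]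
    [ChartedSpace (Model m) M] (p : M) : Type := TangentSpace (𝓡 (2 * m)) p

instance (p : M) : FiniteDimensional ℝ (TangentSpace (𝓡 (2 * m)) p) :=
  inferInstanceAs (FiniteDimensional ℝ (Model m))

instance (p : M) : T2Space (TangentSpace (𝓡 (2 * m)) p) :=
  inferInstanceAs (T2Space (Model m))

/-! ### The Levi-Civita connection -/

/-- The scalar product `g_p` as a bilinear form on `T_pM`. -/
def form (g : Metric m M) (p : M) : LinearMap.BilinForm ℝ (T m p) :=
  LinearMap.mk₂ ℝ (fun X Y => g.inner p X Y) (by simp) (by simp) (by simp) (by simp)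

theorem form_nondegenerate (g : Metric m M) (p : M) : (form g p).Nondegenerate := by
  constructor
  · intro X h
    by_contra h'
    exact (g.pos p X h').ne' (h X)
  · intro X h
    by_contra h'
    exact (g.pos p X h').ne' (h X)

/-- The musical isomorphism `T_pM → T_pM^*`, `X ↦ g_p(X, ·)`. -/
def flat (g : Metric m M) (p : M) : T m p ≃ₗ[ℝ] Module.Dual ℝ (T m p) :=
  (form g p).toDual (form_nondegenerate g p)

/-- The metric in the preferred chart `φ` at `p`: at the point `y` of the model space this is the
matrix `g_q(∂_i, ∂_j)`, as a bilinear form on the model space, where `q = φ⁻¹(y)` and the `∂_i` are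
the coordinate vector fields of `φ`. -/
def metricInChart (g : Metric m M) (p : M) (y : Model m) :
    Model m →L[ℝ] Model m →L[ℝ] ℝ :=
  let q : M := (extChartAt (𝓡 (2 * m)) p).symm y
  let S : Model m →L[ℝ] Model m := (trivializationAt (Model m)
    (fun p : M => TangentSpace (𝓡 (2 * m)) p) p).symmL ℝ q
  let G : Model m →L[ℝ] Model m →L[ℝ] ℝ := g.inner q
  G.bilinearComp S S

/-- The Christoffel symbols `Γ_X` of the Levi-Civita connection `∇` of `g` at `p`, in the preferred
chart at `p`. By the Koszul formula, `2 g(Γ_X Y, Z) = X(g(Y, Z)) + Y(g(X, Z)) - Z(g(X, Y))`;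
the covariant derivative of a vector field with components `Y` is `∇_X Y = dY(X) + Γ_X Y`. -/
def christoffel (g : Metric m M) (p : M) (X : T m p) : T m p →L[ℝ] T m p :=
  let K : T m p →ₗ[ℝ] Module.Dual ℝ (T m p) :=
    koszul (metricInChart g p) (extChartAt (𝓡 (2 * m)) p p) X
  LinearMap.toContinuousLinearMap ((1 / 2 : ℝ) • ((flat g p).symm.toLinearMap ∘ₗ K))

/-! ### Twistor spaces -/

variable (m M) in
/-- An orientation of `M`: an orientation of every tangent space, locally constant in the local
trivializations of `TM`. -/
structure ManifoldOrientation where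
  /-- The orientation of `T_pM`. -/
  at_ : ∀ p : M, Orientation ℝ (T m p) (Fin (2 * m))
  locally_constant : ∀ p : M, ∀ᶠ q in 𝓝 p,
    ∀ hq : q ∈ (trivializationAt (Model m)
      (fun p : M => TangentSpace (𝓡 (2 * m)) p) p).baseSet,
    Orientation.map (Fin (2 * m)) ((trivializationAt (Model m)
        (fun p : M => TangentSpace (𝓡 (2 * m)) p) p).linearEquivAt ℝ q hq) (at_ q) =
      Orientation.map (Fin (2 * m)) ((trivializationAt (Model m)
        (fun p : M => TangentSpace (𝓡 (2 * m)) p) p).linearEquivAt ℝ p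
          (FiberBundle.mem_baseSet_trivializationAt' p)) (at_ p)

/-- `J` is a complex structure on `T_pM` that is orthogonal with respect to `g`. -/
def IsCompatible (g : Metric m M) (p : M) (J : T m p →L[ℝ] T m p) : Prop :=
  (∀ X, J (J X) = -X) ∧ ∀ X Y, g.inner p (J X) (J Y) = g.inner p X Y

/-- The complex structure `J` of `T_pM` induces the orientation `o`: there is a basis of the form
`(e₁, J e₁, …, e_m, J e_m)` that is positive for `o`. -/
def Induces (p : M) (o : Orientation ℝ (T m p) (Fin (2 * m))) (J : T m p →L[ℝ] T m p) : Prop :=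
  ∃ e : Module.Basis (Fin (2 * m)) ℝ (T m p), e.orientation = o ∧
    ∀ (k : ℕ) (hk : k < m), e ⟨2 * k + 1, by omega⟩ = J (e ⟨2 * k, by omega⟩)

/-- The (positive) twistor space of the oriented Riemannian manifold `(M, g)`, as a subset of the
total space of `Hom(TM, TM)`: its fibre over `p` consists of the `g`-orthogonal complex structures
of `T_pM` inducing the orientation of `M`. -/
def twistorSpace (g : Metric m M) (o : ManifoldOrientation m M) : Set (EndBundle m M) :=
  {J | IsCompatible g J.1 J.2 ∧ Induces J.1 (o.at_ J.1) J.2}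

/-- The tangent space at `J` of the total space of `Hom(TM, TM)`. -/
abbrev TEnd (J : EndBundle m M) : Type := TangentSpace (endModel m) J

/-- The tangent vector of `Hom(TM, TM)` at `J` with components `X` (along the base) and `A` (along
the fibre), in the chart of `Hom(TM, TM)` induced by the preferred chart of `M` at the base point
of `J`. -/
def ofComponents (J : EndBundle m M) (X : T m J.1) (A : T m J.1 →L[ℝ] T m J.1) : TEnd J :=
  ((X, A) : Model m ×
    (Model m →L[ℝ] Model m))

/-- The component along the base of a tangent vector of `Hom(TM, TM)`, i.e. its image under the
differential of the projection to `M`. -/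
def baseComponent (J : EndBundle m M) (ξ : TEnd J) : T m J.1 :=
  Prod.fst (α := Model m)
    (β := Model m →L[ℝ] Model m) ξ

/-- The component along the fibre of a tangent vector of `Hom(TM, TM)`, in the same chart as in
`ofComponents`. -/
def fibreComponent (J : EndBundle m M) (ξ : TEnd J) : T m J.1 →L[ℝ] T m J.1 :=
  Prod.snd (α := Model m)
    (β := Model m →L[ℝ] Model m) ξ

/-- The vertical tangent vector at `J` given by the endomorphism `U` of `T_pM`. -/
def vertical (J : EndBundle m M) (U : T m J.1 →L[ℝ] T m J.1) : TEnd J := ofComponents J 0 U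

/-- The horizontal lift `X^h_J`, with respect to the connection on `Hom(TM, TM)` induced by the
Levi-Civita connection of `g`. That connection is `∇_X S = dS(X) + [Γ_X, S]` in a chart, so that
the velocity `(X, dS(X))` of a section `S` with `S(p) = J` and `∇_X S = 0` at `p` is
`(X, -[Γ_X, J])`. -/
def horizontalLift (g : Metric m M) (J : EndBundle m M) (X : T m J.1) : TEnd J :=
  ofComponents J X (J.2 ∘L christoffel g J.1 X - christoffel g J.1 X ∘L J.2)

/-- The vertical part of a tangent vector `ξ = X^h_J + U` of `Hom(TM, TM)`, as the endomorphism
`U`. -/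
def verticalPart (g : Metric m M) (J : EndBundle m M) (ξ : TEnd J) : T m J.1 →L[ℝ] T m J.1 :=
  fibreComponent J (ξ - horizontalLift g J (baseComponent J ξ))

/-- `U` is tangent at `J` to the fibre of the twistor space of `(M, g)` through `J`: it is
`g`-skew-symmetric and anti-commutes with `J`. -/
def IsTangentToFibre (g : Metric m M) (J : EndBundle m M) (U : T m J.1 →L[ℝ] T m J.1) : Prop :=
  (∀ X Y, g.inner J.1 (U X) Y = -g.inner J.1 X (U Y)) ∧ ∀ X, U (J.2 X) = -J.2 (U X)

/-- The tangent space at a point `J` of the twistor space of `(M, g)`, `T_J Z = H_J ⊕ V_J`. -/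
def twistorTangent (g : Metric m M) (J : EndBundle m M) : Set (TEnd J) :=
  {ξ | ∃ (X : T m J.1) (U : T m J.1 →L[ℝ] T m J.1), IsTangentToFibre g J U ∧
    ξ = horizontalLift g J X + vertical J U}

/-- The Atiyah-Hitchin-Singer almost complex structure `X^h_J + U ↦ (J X)^h_J + J ∘ U` on the
twistor space of `(M, g)`. -/
def atiyahHitchinSinger (g : Metric m M) (J : EndBundle m M) (ξ : TEnd J) : TEnd J :=
  horizontalLift g J (J.2 (baseComponent J ξ)) + vertical J (J.2 ∘L verticalPart g J ξ)

/-- The Eells-Salamon almost complex structure `X^h_J + U ↦ (J X)^h_J - J ∘ U` on the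
twistor space of `(M, g)`. -/
def eellsSalamon (g : Metric m M) (J : EndBundle m M) (ξ : TEnd J) : TEnd J :=
  horizontalLift g J (J.2 (baseComponent J ξ)) - vertical J (J.2 ∘L verticalPart g J ξ)

/-! ### The map between the twistor spaces of two metrics -/

/-- The endomorphism `C` of `T_pM` with `g(C X, Y) = g'(X, Y)`. -/
def relEnd (g g' : Metric m M) (p : M) : T m p →ₗ[ℝ] T m p :=
  (flat g p).symm.toLinearMap ∘ₗ form g' p

theorem inner_relEnd (g g' : Metric m M) (p : M) (X Y : T m p) :
    g.inner p (relEnd g g' p X) Y = g'.inner p X Y := by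
  have h : flat g p (relEnd g g' p X) = form g' p X := (flat g p).apply_symm_apply _
  exact congrArg (fun f : Module.Dual ℝ (T m p) => f Y) h

theorem exists_rootEnd (g g' : Metric m M) (p : M) :
    ∃ Q : T m p →ₗ[ℝ] T m p, (∀ X Y, g.inner p (Q X) Y = g.inner p X (Q Y)) ∧
      (∀ X, X ≠ 0 → 0 < g.inner p (Q X) X) ∧ ∀ X, Q (Q X) = relEnd g g' p X :=
  exists_sqrt (form g p) (g.symm p) (g.pos p) (relEnd g g' p)
    (fun X Y => by
      change g.inner p _ _ = g.inner p _ _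
      rw [inner_relEnd, g.symm p X, inner_relEnd, g'.symm])
    (fun X hX => by
      change 0 < g.inner p _ _
      rw [inner_relEnd]
      exact g'.pos p X hX)

/-- The principal square root `Q` of `C`: the `g`-symmetric positive definite endomorphism of
`T_pM` with `Q² = C`. -/
def rootEnd (g g' : Metric m M) (p : M) : T m p →ₗ[ℝ] T m p := (exists_rootEnd g g' p).choose

theorem rootEnd_injective (g g' : Metric m M) (p : M) : Function.Injective (rootEnd g g' p) := by
  rw [injective_iff_map_eq_zero]
  intro X hX
  by_contra h
  have := (exists_rootEnd g g' p).choose_spec.2.1 X h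
  change 0 < g.inner p (rootEnd g g' p X) X at this
  simp [hX] at this

/-- `Q` as an automorphism of `T_pM`. -/
def root (g g' : Metric m M) (p : M) : T m p ≃L[ℝ] T m p :=
  (LinearEquiv.ofInjectiveEndo (rootEnd g g' p) (rootEnd_injective g g' p)).toContinuousLinearEquiv

/-- The bundle map `Ψ` of `Hom(TM, TM)`, `Ψ(A) = Q⁻¹ A Q`. Its restriction to the twistor space of
`g` is the map `Ψ` to the twistor space of `g'`. -/
def psi (g g' : Metric m M) (A : EndBundle m M) : EndBundle m M :=
  ⟨A.1, ((root g g' A.1).symm : T m A.1 →L[ℝ] T m A.1) ∘L A.2 ∘L (root g g' A.1 : T m A.1 →L[ℝ] T m A.1)⟩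

theorem root_adj (g g' : Metric m M) (p : M) (X Y : T m p) :
    g.inner p (root g g' p X) Y = g.inner p X (root g g' p Y) :=
  (exists_rootEnd g g' p).choose_spec.1 X Y

theorem inner_root_root (g g' : Metric m M) (p : M) (X Y : T m p) :
    g.inner p (root g g' p X) (root g g' p Y) = g'.inner p X Y := by
  rw [← root_adj, ← inner_relEnd g g']
  exact congrArg (fun Z => g.inner p Z Y) ((exists_rootEnd g g' p).choose_spec.2.2 X)

theorem det_root_pos (g g' : Metric m M) (p : M) :
    0 < LinearMap.det ((root g g' p).toLinearEquiv : T m p →ₗ[ℝ] T m p) := by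
  obtain ⟨R, -, -, hR⟩ := exists_sqrt (form g p) (g.symm p) (g.pos p) (rootEnd g g' p)
    (exists_rootEnd g g' p).choose_spec.1 (exists_rootEnd g g' p).choose_spec.2.1
  have h : ((root g g' p).toLinearEquiv : T m p →ₗ[ℝ] T m p) = R ∘ₗ R :=
    LinearMap.ext fun X => (hR X).symm
  have h0 : LinearMap.det ((root g g' p).toLinearEquiv : T m p →ₗ[ℝ] T m p) ≠ 0 :=
    (LinearEquiv.isUnit_det' (root g g' p).toLinearEquiv).ne_zero
  rw [h, LinearMap.det_comp] at h0 ⊢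
  exact lt_of_le_of_ne (mul_self_nonneg _) h0.symm

theorem isCompatible_conj (g g' : Metric m M) (p : M) (J : T m p →L[ℝ] T m p)
    (hJ : IsCompatible g p J) : IsCompatible g' p
      (((root g g' p).symm : T m p →L[ℝ] T m p) ∘L J ∘L (root g g' p : T m p →L[ℝ] T m p)) := by
  refine ⟨fun X => ?_, fun X Y => ?_⟩
  · simp [hJ.1]
  · rw [← inner_root_root g g', ← inner_root_root g g' p X Y]
    simp [hJ.2]

theorem induces_conj (g g' : Metric m M) (p : M) (o : Orientation ℝ (T m p) (Fin (2 * m)))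
    (J : T m p →L[ℝ] T m p) (hJ : Induces p o J) : Induces p o
      (((root g g' p).symm : T m p →L[ℝ] T m p) ∘L J ∘L (root g g' p : T m p →L[ℝ] T m p)) := by
  obtain ⟨e, he, hJ⟩ := hJ
  refine ⟨e.map (root g g' p).toLinearEquiv.symm, ?_, fun k hk => ?_⟩
  · rw [← he, Module.Basis.orientation_comp_linearEquiv_eq_iff_det_pos]
    refine pos_of_mul_pos_left ?_ (det_root_pos g g' p).le
    rw [LinearEquiv.det_symm_mul_det]
    exact one_pos
  · simp [hJ k hk]

/-- `Ψ` maps the twistor space of `g` to that of `g'`. -/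
theorem psi_mapsTo (g g' : Metric m M) (o : ManifoldOrientation m M) :
    Set.MapsTo (psi g g') (twistorSpace g o) (twistorSpace g' o) := fun J hJ =>
  ⟨isCompatible_conj g g' J.1 J.2 hJ.1, induces_conj g g' J.1 (o.at_ J.1) J.2 hJ.2⟩

/-! ### Holomorphic maps -/

/-- A map `Φ` of `Hom(TM, TM)` into itself is smooth, and restricts to a map of the twistor space of
`g` to the twistor space of `g'`. -/
def IsTwistorMap (g g' : Metric m M) (o : ManifoldOrientation m M)
    (Φ : EndBundle m M → EndBundle m M) : Prop :=
  ContMDiff (endModel m) (endModel m) ∞ Φ ∧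
    Set.MapsTo Φ (twistorSpace g o) (twistorSpace g' o)

/-- The smooth map `Φ` from the twistor space of `g`, with the almost complex structure `𝒥`, to the
twistor space of `g'`, with `𝒥'`, is (pseudo-)holomorphic: `𝒥' ∘ Φ_* = Φ_* ∘ 𝒥`. -/
def IsHolomorphic (g g' : Metric m M) (o : ManifoldOrientation m M)
    (𝒥 𝒥' : (J : EndBundle m M) → TEnd J → TEnd J) (Φ : EndBundle m M → EndBundle m M) : Prop :=
  IsTwistorMap g g' o Φ ∧ ∀ J ∈ twistorSpace g o, ∀ ξ ∈ twistorTangent g J,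
    𝒥' (Φ J) (mfderiv (endModel m) (endModel m) Φ J ξ) =
      mfderiv (endModel m) (endModel m) Φ J (𝒥 J ξ)

/-- The smooth map `Φ` from the twistor space of `g`, with the almost complex structure `𝒥`, to the
twistor space of `g'`, with `𝒥'`, is anti-holomorphic: `𝒥' ∘ Φ_* = -Φ_* ∘ 𝒥`. -/
def IsAntiHolomorphic (g g' : Metric m M) (o : ManifoldOrientation m M)
    (𝒥 𝒥' : (J : EndBundle m M) → TEnd J → TEnd J) (Φ : EndBundle m M → EndBundle m M) : Prop :=
  IsTwistorMap g g' o Φ ∧ ∀ J ∈ twistorSpace g o, ∀ ξ ∈ twistorTangent g J,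
    𝒥' (Φ J) (mfderiv (endModel m) (endModel m) Φ J ξ) =
      -mfderiv (endModel m) (endModel m) Φ J (𝒥 J ξ)

end Manifold
end Twistor
end

namespace Twistor

/-! ### Linear algebra: orthogonal complex structures and skew endomorphisms anti-commuting with
them. -/

section LinearAlgebra

variable {V : Type*} [AddCommGroup V] [Module ℝ V]

/-! `Ψ` covers the identity of `M` and is conjugation by `Q`, hence linear, on each fibre of
`Hom(TM, TM)`. Two independent obstructions follow.

Base directions rule out anti-holomorphy (`not_antiHolomorphic_psi`). Both almost complex structures
act on base components by `J`, and `Ψ_*` preserves base components, so anti-holomorphy forces `Q⁻¹JQ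
= -J`, i.e. `JQ = -QJ`. Then `g(QX, X) = g(JQX, JX) = -g(QJX, JX)`, impossible for positive definite
`Q` (`psi_snd_ne_neg`).

Fibre directions rule out holomorphy (`not_holomorphic_psi`). On a vertical vector `U` the two
structures are `J ∘ U` and `-J ∘ U`, and `Ψ_* U = Q⁻¹UQ` (`mfderiv_psi_vertical`). Holomorphy
between structures of opposite sign gives `Q⁻¹JUQ = -Q⁻¹JUQ`, so `U = 0`. In dimension at least 4 a
non-zero vertical `U` exists (`exists_mem_twistorSpace`).

The curvature and the actual values of the Christoffel symbols play no role. -/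

/-- An oriented Euclidean space has a positively oriented orthonormal basis. -/
theorem exists_oriented_orthonormal_basis [FiniteDimensional ℝ V]
    (b : V →ₗ[ℝ] V →ₗ[ℝ] ℝ) (symm : ∀ x y, b x y = b y x) (pos : ∀ x, x ≠ 0 → 0 < b x x)
    {n : ℕ} [NeZero n] (hn : Module.finrank ℝ V = n) (o : Orientation ℝ V (Fin n)) :
    ∃ e : Module.Basis (Fin n) ℝ V, e.orientation = o ∧
      ∀ i j, b (e i) (e j) = if i = j then 1 else 0 := by
  let core : InnerProductSpace.Core ℝ V :=
    { inner := fun x y => b x y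
      conj_inner_symm := fun x y => by simpa using symm y x
      re_inner_nonneg := fun x => by
        rcases eq_or_ne x 0 with rfl | h
        · simp
        · simpa using (pos x h).le
      add_left := fun x y z => by simp
      smul_left := fun x y r => by simp
      definite := fun x h => by
        by_contra h'
        exact (pos x h').ne' h }
  let _ : NormedAddCommGroup V := core.toNormedAddCommGroup
  let _ : InnerProductSpace ℝ V := InnerProductSpace.ofCore core.toCore
  -- A wrong orientation is corrected by negating one basis vector; `NeZero n` guarantees that there
  -- is one.
  let e := ((stdOrthonormalBasis ℝ V).reindex (finCongr hn)).adjustToOrientation o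
  refine ⟨e.toBasis, OrthonormalBasis.orientation_adjustToOrientation _ _, fun i j => ?_⟩
  have h := orthonormal_iff_ite.1 e.orthonormal i j
  rwa [← e.coe_toBasis] at h

/-- The endomorphism with `e (2k) ↦ e (2k+1)` and `e (2k+1) ↦ -e (2k)` for a basis `e`. -/
noncomputable def pairingEnd {m : ℕ} (e : Module.Basis (Fin (2 * m)) ℝ V) : V →ₗ[ℝ] V :=
  e.constr ℝ fun i =>
    if h : i.1 % 2 = 0 then e ⟨i.1 + 1, by omega⟩ else -e ⟨i.1 - 1, by omega⟩

theorem pairingEnd_even {m : ℕ} (e : Module.Basis (Fin (2 * m)) ℝ V) (k : ℕ) (hk : k < m) :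
    pairingEnd e (e ⟨2 * k, by omega⟩) = e ⟨2 * k + 1, by omega⟩ := by
  rw [pairingEnd, e.constr_basis]
  simp

theorem pairingEnd_odd {m : ℕ} (e : Module.Basis (Fin (2 * m)) ℝ V) (k : ℕ) (hk : k < m) :
    pairingEnd e (e ⟨2 * k + 1, by omega⟩) = -e ⟨2 * k, by omega⟩ := by
  rw [pairingEnd, e.constr_basis]
  simp

theorem exists_eq_two_mul_or {m : ℕ} (i : Fin (2 * m)) : ∃ (k : ℕ) (hk : k < m),
    i = ⟨2 * k, by omega⟩ ∨ i = ⟨2 * k + 1, by omega⟩ := by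
  refine ⟨i.1 / 2, by omega, ?_⟩
  simp only [Fin.ext_iff]
  omega

theorem pairingEnd_pairingEnd {m : ℕ} (e : Module.Basis (Fin (2 * m)) ℝ V) (x : V) :
    pairingEnd e (pairingEnd e x) = -x := by
  have : pairingEnd e ∘ₗ pairingEnd e = -LinearMap.id := e.ext fun i => by
    obtain ⟨k, hk, rfl | rfl⟩ := exists_eq_two_mul_or i <;>
      simp [pairingEnd_even e k hk, pairingEnd_odd e k hk]
  exact congrArg (fun f : V →ₗ[ℝ] V => f x) this

theorem pairingEnd_isometry {m : ℕ} (b : V →ₗ[ℝ] V →ₗ[ℝ] ℝ)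
    (e : Module.Basis (Fin (2 * m)) ℝ V) (he : ∀ i j, b (e i) (e j) = if i = j then 1 else 0)
    (x y : V) : b (pairingEnd e x) (pairingEnd e y) = b x y := by
  -- Up to sign the endomorphism permutes an orthonormal basis. Indices of different parity are
  -- never equal, which settles the mixed cases.
  have : b.compl₁₂ (pairingEnd e) (pairingEnd e) = b := e.ext fun i => e.ext fun j => by
    obtain ⟨k, hk, rfl | rfl⟩ := exists_eq_two_mul_or i <;>
    obtain ⟨l, hl, rfl | rfl⟩ := exists_eq_two_mul_or j <;>
    simp only [LinearMap.compl₁₂_apply, pairingEnd_even e _ hk, pairingEnd_odd e _ hk,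
      pairingEnd_even e _ hl, pairingEnd_odd e _ hl, he, map_neg, LinearMap.neg_apply,
      Fin.mk.injEq] <;>
    split_ifs <;> first | omega | simp
  exact congrArg (fun f : V →ₗ[ℝ] V →ₗ[ℝ] ℝ => f x y) this

/-- If `J` is an orthogonal complex structure and `v ≠ 0` is orthogonal to `u` and `J u`, then there
is a skew-symmetric endomorphism anti-commuting with `J` that does not vanish. -/
theorem exists_skew_anticommuting (b : V →ₗ[ℝ] V →ₗ[ℝ] ℝ) (symm : ∀ x y, b x y = b y x)
    (J : V →ₗ[ℝ] V) (hJ : ∀ x, J (J x) = -x) (hJ' : ∀ x y, b (J x) (J y) = b x y)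
    {u v : V} (hu : b u u ≠ 0) (hv : v ≠ 0) (huv : b u v = 0) (hJuv : b (J u) v = 0) :
    ∃ U : V →ₗ[ℝ] V, (∀ x y, b (U x) y = -b x (U y)) ∧ (∀ x, U (J x) = -J (U x)) ∧ U ≠ 0 := by
  -- `A` generates rotations in the plane of `u` and `v`. The sum `A + JAJ` is twice its part
  -- anti-commuting with `J`, and its value at `u` is `b(u, u) v`, because `A(Ju) = 0`.
  let A : V →ₗ[ℝ] V := (b u).smulRight v - (b v).smulRight u
  have hA : ∀ x, A x = b u x • v - b v x • u := fun x => rfl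
  have hskew : ∀ x y, b (J x) y = -b x (J y) := fun x y => by
    rw [← hJ' x (J y), hJ, map_neg, neg_neg]
  have hAskew : ∀ x y, b (A x) y = -b x (A y) := fun x y => by
    simp only [hA, map_sub, map_smul, LinearMap.sub_apply, LinearMap.smul_apply, smul_eq_mul,
      symm x u, symm x v]
    ring
  refine ⟨A + J ∘ₗ A ∘ₗ J, fun x y => ?_, fun x => ?_, fun h => hv ?_⟩
  · simp only [LinearMap.add_apply, LinearMap.comp_apply, map_add, hskew, hAskew, neg_neg]
    ring
  · simp only [LinearMap.add_apply, LinearMap.comp_apply, map_add, map_neg, hJ]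
    abel
  · have h1 : (A + J ∘ₗ A ∘ₗ J) u = 0 := by rw [h]; rfl
    have h2 : b u (J u) = 0 := by
      have := hskew u u
      rw [symm] at this
      linarith
    have h3 : b v (J u) = 0 := by rw [symm, hJuv]
    have h4 : b v u = 0 := by rw [symm, huv]
    simpa [hA, h2, h3, h4, hu] using h1

end LinearAlgebra

section Manifold

variable {m : ℕ} {M : Type*} [TopologicalSpace M]
  [ChartedSpace (Model m) M] [IsManifold (𝓡 (2 * m)) ∞ M]

/-- Over every point there is a point `J` of the twistor space at which the fibre has a non-zero
tangent vector. -/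
theorem exists_mem_twistorSpace (hm : 2 ≤ m) (g : Metric m M) (o : ManifoldOrientation m M)
    (p : M) : ∃ (J : T m p →L[ℝ] T m p) (U : T m p →L[ℝ] T m p),
      (⟨p, J⟩ : EndBundle m M) ∈ twistorSpace g o ∧ IsTangentToFibre g ⟨p, J⟩ U ∧ U ≠ 0 := by
  have : NeZero (2 * m) := ⟨by omega⟩
  obtain ⟨e, heo, he⟩ := exists_oriented_orthonormal_basis (form g p) (g.symm p) (g.pos p)
    (n := 2 * m) (finrank_euclideanSpace_fin (𝕜 := ℝ)) (o.at_ p)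
  obtain ⟨U, hU, hUJ, hU0⟩ := exists_skew_anticommuting (form g p) (g.symm p) (pairingEnd e)
    (pairingEnd_pairingEnd e) (pairingEnd_isometry (form g p) e he)
    -- The second vector lies in a different `J`-plane from the first; this is where `2 ≤ m` is
    -- needed.
    (u := e ⟨2 * 0, by omega⟩) (v := e ⟨2 * 1, by omega⟩)
    (by simp [he]) (e.ne_zero _) (by simp [he])
    (by rw [pairingEnd_even e 0 (by omega)]; simp [he])
  refine ⟨LinearMap.toContinuousLinearMap (pairingEnd e), LinearMap.toContinuousLinearMap U,
    ⟨⟨pairingEnd_pairingEnd e, pairingEnd_isometry (form g p) e he⟩, e, heo,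
      fun k hk => (pairingEnd_even e k hk).symm⟩, ⟨hU, hUJ⟩, fun h => hU0 ?_⟩
  exact LinearMap.toContinuousLinearMap.injective (h.trans (map_zero _).symm)

/-! ### Derivatives of the fibre inclusion and of the projection. -/

/-- `T_pM` is identified with the model space through the preferred chart at `p`, and the coordinate
change from that chart to itself is the identity. -/
theorem trivializationAt_mk (p : M) (A : T m p →L[ℝ] T m p) :
    trivializationAt (Model m →L[ℝ] Model m)
      (fun p : M => TangentSpace (𝓡 (2 * m)) p →L[ℝ] TangentSpace (𝓡 (2 * m)) p) p
      (⟨p, A⟩ : EndBundle m M) = (p, A) := by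
  rw [hom_trivializationAt_apply, ContinuousLinearMap.inCoordinates,
    TangentBundle.continuousLinearMapAt_trivializationAt_eq_core (mem_chart_source _ p),
    TangentBundle.symmL_trivializationAt_eq_core (mem_chart_source _ p)]
  refine Prod.ext rfl (ContinuousLinearMap.ext fun v => ?_)
  have h := (tangentBundleCore (𝓡 (2 * m)) M).coordChange_self (achart (Model m) p) p
    (mem_chart_source _ p)
  exact (h _).trans (congrArg A (h v))

/-- The inclusion of a fibre into `Hom(TM, TM)` has the derivative `U ↦ vertical U`. -/
theorem hasMFDerivAt_mk (p : M) (A : Model m →L[ℝ] Model m) :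
    HasMFDerivAt 𝓘(ℝ, Model m →L[ℝ] Model m) (endModel m)
      (fun A : Model m →L[ℝ] Model m => (⟨p, A⟩ : EndBundle m M)) A
      (ContinuousLinearMap.inr ℝ (Model m) (Model m →L[ℝ] Model m)) := by
  refine ⟨(FiberBundle.continuous_totalSpaceMk _ _ p).continuousAt, ?_⟩
  -- The bundle chart at a point depends only on its base point, so in coordinates the inclusion is
  -- affine: constant in the base, the identity in the fibre.
  have h : writtenInExtChartAt 𝓘(ℝ, Model m →L[ℝ] Model m) (endModel m) A
      (fun A : Model m →L[ℝ] Model m => (⟨p, A⟩ : EndBundle m M)) =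
      fun A => (extChartAt (𝓡 (2 * m)) p p, A) := by
    funext B
    simp only [writtenInExtChartAt, FiberBundle.extChartAt, Function.comp_apply,
      PartialEquiv.coe_trans, extChartAt_model_space_eq_id, PartialEquiv.refl_symm,
      PartialEquiv.refl_coe, id]
    exact congrArg (Prod.map (extChartAt (𝓡 (2 * m)) p) id) (trivializationAt_mk p B)
  rw [h]
  exact ((hasFDerivAt_const _ _).prodMk (hasFDerivAt_id _)).hasFDerivWithinAt

/-- On the whole target of a bundle chart the projection reads as the first coordinate. -/
theorem hasMFDerivAt_proj (J : EndBundle m M) :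
    HasMFDerivAt (endModel m) (𝓡 (2 * m)) (fun A : EndBundle m M => A.1) J
      (ContinuousLinearMap.fst ℝ (Model m) (Model m →L[ℝ] Model m)) := by
  refine ⟨(FiberBundle.continuous_proj _ _).continuousAt, ?_⟩
  have h : ∀ y ∈ (extChartAt (endModel m) J).target,
      writtenInExtChartAt (endModel m) (𝓡 (2 * m)) J (fun A : EndBundle m M => A.1) y = y.1 := by
    intro y hy
    rw [FiberBundle.extChartAt_target] at hy
    have h1 : ((extChartAt (endModel m) J).symm y).1 = (extChartAt (𝓡 (2 * m)) J.1).symm y.1 := by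
      rw [FiberBundle.extChartAt]
      exact (trivializationAt (Model m →L[ℝ] Model m)
        (fun p : M => TangentSpace (𝓡 (2 * m)) p →L[ℝ] TangentSpace (𝓡 (2 * m)) p)
        J.1).proj_symm_apply' hy.1.2
    rw [writtenInExtChartAt, Function.comp_apply, Function.comp_apply, h1]
    exact (extChartAt (𝓡 (2 * m)) J.1).right_inv hy.1.1
  exact (hasFDerivWithinAt_fst (𝕜 := ℝ) (E := Model m)
    (F := Model m →L[ℝ] Model m)).congr_of_eventuallyEq
      (Filter.eventually_of_mem (extChartAt_target_mem_nhdsWithin J) h)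
      (h _ (mem_extChartAt_target J))

/-! ### Horizontal lifts, vertical parts and the differential of `Ψ`. -/

/-- The Koszul form is linear in `X`. Nothing else about the Christoffel symbols is used: it makes
vertical vectors their own vertical parts. -/
theorem christoffel_zero (g : Metric m M) (p : M) : christoffel g p 0 = 0 := by
  ext Y
  have h : koszul (metricInChart g p) (extChartAt (𝓡 (2 * m)) p p) 0 = 0 := by
    ext Y Z
    simp [koszul, koszulForm]
  change (1 / 2 : ℝ) • (flat g p).symm
    (koszul (metricInChart g p) (extChartAt (𝓡 (2 * m)) p p) 0 Y) = 0
  rw [h]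
  exact (congrArg _ (map_zero (flat g p).symm)).trans (smul_zero _)

theorem horizontalLift_zero (g : Metric m M) (J : EndBundle m M) : horizontalLift g J 0 = 0 := by
  simp [horizontalLift, christoffel_zero]
  rfl

theorem verticalPart_vertical (g : Metric m M) (J : EndBundle m M) (U : T m J.1 →L[ℝ] T m J.1) :
    verticalPart g J (vertical J U) = U := by
  have : baseComponent J (vertical J U) = 0 := rfl
  rw [verticalPart, this, horizontalLift_zero, sub_zero]
  rfl

/-- With `π` the projection to `M`, `π ∘ Ψ = π` holds by definition, so the chain rule and
uniqueness of derivatives apply. -/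
theorem baseComponent_mfderiv_psi (g g' : Metric m M)
    (hΨ : MDifferentiable (endModel m) (endModel m) (psi g g'))
    (J : EndBundle m M) (ξ : TEnd J) :
    baseComponent (psi g g' J) (mfderiv (endModel m) (endModel m) (psi g g') J ξ) =
      baseComponent J ξ := by
  have h := HasMFDerivAt.comp J (hasMFDerivAt_proj (psi g g' J)) (hΨ J).hasMFDerivAt
  have h' := hasMFDerivAt_unique h (hasMFDerivAt_proj J)
  exact congrArg (fun f : Model m × (Model m →L[ℝ] Model m) →L[ℝ] Model m => f ξ) h'

/-- Restricted to a fibre, `Ψ` is the linear map of conjugation by `Q`, which is its own derivative.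
-/
theorem mfderiv_psi_vertical (g g' : Metric m M)
    (hΨ : MDifferentiable (endModel m) (endModel m) (psi g g'))
    (J : EndBundle m M) (U : T m J.1 →L[ℝ] T m J.1) :
    mfderiv (endModel m) (endModel m) (psi g g') J (vertical J U) =
      vertical (psi g g' J) (psi g g' ⟨J.1, U⟩).2 := by
  let A : Model m →L[ℝ] Model m := J.2
  let R : Model m →L[ℝ] Model m := (root g g' J.1 : T m J.1 →L[ℝ] T m J.1)
  let S : Model m →L[ℝ] Model m := ((root g g' J.1).symm : T m J.1 →L[ℝ] T m J.1)
  let c : (Model m →L[ℝ] Model m) →L[ℝ] (Model m →L[ℝ] Model m) :=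
    ContinuousLinearMap.compL ℝ (Model m) (Model m) (Model m) S ∘L
      (ContinuousLinearMap.compL ℝ (Model m) (Model m) (Model m)).flip R
  -- `Ψ` after the fibre inclusion, and the fibre inclusion after `c`, are the same map by
  -- definition; their two derivatives are compared.
  have h := HasMFDerivAt.comp A (hΨ J).hasMFDerivAt (hasMFDerivAt_mk J.1 A)
  have h' := HasMFDerivAt.comp A (hasMFDerivAt_mk J.1 (c A)) c.hasFDerivAt.hasMFDerivAt
  exact congrArg
    (fun f : (Model m →L[ℝ] Model m) →L[ℝ] Model m × (Model m →L[ℝ] Model m) => f U)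
    (hasMFDerivAt_unique h h')

theorem horizontalLift_mem_twistorTangent (g : Metric m M) (J : EndBundle m M) (X : T m J.1) :
    horizontalLift g J X ∈ twistorTangent g J :=
  ⟨X, 0, ⟨by simp, by simp⟩, (add_zero (horizontalLift g J X)).symm⟩

theorem vertical_mem_twistorTangent (g : Metric m M) (J : EndBundle m M)
    {U : T m J.1 →L[ℝ] T m J.1} (hU : IsTangentToFibre g J U) :
    vertical J U ∈ twistorTangent g J :=
  ⟨0, U, hU, by rw [horizontalLift_zero, zero_add]⟩

/-! ### The almost complex structures on vertical vectors and on base components. -/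

theorem atiyahHitchinSinger_vertical (g : Metric m M) (J : EndBundle m M)
    (U : T m J.1 →L[ℝ] T m J.1) :
    atiyahHitchinSinger g J (vertical J U) = vertical J (J.2 ∘L U) := by
  have h : J.2 (baseComponent J (vertical J U)) = 0 := map_zero J.2
  rw [atiyahHitchinSinger, verticalPart_vertical, h, horizontalLift_zero, zero_add]

theorem eellsSalamon_vertical (g : Metric m M) (J : EndBundle m M)
    (U : T m J.1 →L[ℝ] T m J.1) :
    eellsSalamon g J (vertical J U) = -vertical J (J.2 ∘L U) := by
  have h : J.2 (baseComponent J (vertical J U)) = 0 := map_zero J.2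
  rw [eellsSalamon, verticalPart_vertical, h, horizontalLift_zero, zero_sub]

theorem baseComponent_atiyahHitchinSinger (g : Metric m M) (J : EndBundle m M) (ξ : TEnd J) :
    baseComponent J (atiyahHitchinSinger g J ξ) = J.2 (baseComponent J ξ) :=
  add_zero (J.2 (baseComponent J ξ))

theorem baseComponent_eellsSalamon (g : Metric m M) (J : EndBundle m M) (ξ : TEnd J) :
    baseComponent J (eellsSalamon g J ξ) = J.2 (baseComponent J ξ) :=
  sub_zero (J.2 (baseComponent J ξ))

/-! ### The two obstructions. -/

/-- Conjugation by the positive definite `Q` does not map a `g`-orthogonal complex structure to its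
negative. -/
theorem psi_snd_ne_neg (hm : 2 ≤ m) (g g' : Metric m M) (J : EndBundle m M)
    (hJ : IsCompatible g J.1 J.2) : ¬ ∀ X, (psi g g' J).2 X = -J.2 X := by
  intro h
  have : Nontrivial (T m J.1) :=
    Module.nontrivial_of_finrank_pos (R := ℝ)
      ((finrank_euclideanSpace_fin (𝕜 := ℝ) (n := 2 * m)).symm ▸ by omega)
  obtain ⟨X, hX⟩ := exists_ne (0 : T m J.1)
  have hpos : ∀ Y, Y ≠ 0 → 0 < g.inner J.1 (root g g' J.1 Y) Y :=
    (exists_rootEnd g g' J.1).choose_spec.2.1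
  have hJX : J.2 X ≠ 0 := fun h0 => hX (by simpa [h0] using hJ.1 X)
  have h1 : J.2 (root g g' J.1 X) = -root g g' J.1 (J.2 X) := by
    rw [← map_neg, ← h X]
    exact ((root g g' J.1).apply_symm_apply _).symm
  -- After substituting `JQX = -QJX`, the left side is `-g(QJX, JX) < 0` and the right side is
  -- `g(QX, X) > 0`.
  have h2 := hJ.2 (root g g' J.1 X) X
  rw [h1, map_neg, neg_apply] at h2
  linarith [hpos X hX, hpos (J.2 X) hJX]

/-- Projecting the anti-holomorphy equation at a horizontal lift of `X` to the base gives `Ψ(J)X =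
-JX`. Only the action on base components enters, so both pairs of structures are covered. -/
theorem not_antiHolomorphic_psi (hm : 2 ≤ m) [Nonempty M] (o : ManifoldOrientation m M)
    (g g' : Metric m M) (𝒥 𝒥' : (J : EndBundle m M) → TEnd J → TEnd J)
    (h𝒥 : ∀ J ξ, baseComponent J (𝒥 J ξ) = J.2 (baseComponent J ξ))
    (h𝒥' : ∀ J ξ, baseComponent J (𝒥' J ξ) = J.2 (baseComponent J ξ)) :
    ¬ IsAntiHolomorphic g g' o 𝒥 𝒥' (psi g g') := by
  rintro ⟨⟨hΨ, -⟩, h⟩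
  -- Smoothness of `Ψ` is part of the property being refuted, hence available here.
  have hΨ := hΨ.mdifferentiable (by simp)
  obtain ⟨J, -, hJ, -, -⟩ := exists_mem_twistorSpace hm g o (Classical.arbitrary M)
  refine psi_snd_ne_neg hm g g' _ hJ.1 fun X => ?_
  have h1 := congrArg (baseComponent _)
    (h _ hJ _ (horizontalLift_mem_twistorTangent g ⟨_, J⟩ X))
  rw [h𝒥', baseComponent_mfderiv_psi g g' hΨ] at h1
  exact h1.trans (congrArg Neg.neg ((baseComponent_mfderiv_psi g g' hΨ _ _).trans (h𝒥 _ _)))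

/-- The scalar `ε` records the sign of `𝒥` on vertical vectors, and `𝒥'` has the opposite one.
Conjugation respects composition, so the equation at `U` becomes `2ε Q⁻¹JUQ = 0`. -/
theorem not_holomorphic_psi (hm : 2 ≤ m) [Nonempty M] (o : ManifoldOrientation m M)
    (g g' : Metric m M) (𝒥 𝒥' : (J : EndBundle m M) → TEnd J → TEnd J) (ε : ℝ) (hε : ε ≠ 0)
    (h𝒥 : ∀ J U, 𝒥 J (vertical J U) = ε • vertical J (J.2 ∘L U))
    (h𝒥' : ∀ J U, 𝒥' J (vertical J U) = -ε • vertical J (J.2 ∘L U)) :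
    ¬ IsHolomorphic g g' o 𝒥 𝒥' (psi g g') := by
  rintro ⟨⟨hΨ, -⟩, h⟩
  have hΨ := hΨ.mdifferentiable (by simp)
  obtain ⟨J, U, hJ, hU, hU0⟩ := exists_mem_twistorSpace hm g o (Classical.arbitrary M)
  refine hU0 (ContinuousLinearMap.ext fun X => ?_)
  let p : M := Classical.arbitrary M
  let Q : T m p ≃L[ℝ] T m p := root g g' p
  let J' : EndBundle m M := ⟨p, J⟩
  let U' : T m p →L[ℝ] T m p := (psi g g' ⟨p, U⟩).2
  let W : T m p →L[ℝ] T m p := (psi g g' ⟨p, J ∘L U⟩).2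
  have h1 : -ε • vertical (psi g g' J') ((psi g g' J').2 ∘L U') =
      ε • vertical (psi g g' J') W := by
    calc
      _ = 𝒥' (psi g g' J') (vertical (psi g g' J') U') := (h𝒥' (psi g g' J') U').symm
      _ = 𝒥' (psi g g' J') (mfderiv (endModel m) (endModel m) (psi g g') J' (vertical J' U)) :=
        congrArg _ (mfderiv_psi_vertical g g' hΨ J' U).symm
      _ = mfderiv (endModel m) (endModel m) (psi g g') J' (𝒥 J' (vertical J' U)) :=
        h _ hJ _ (vertical_mem_twistorTangent g _ hU)
      _ = ε • mfderiv (endModel m) (endModel m) (psi g g') J' (vertical J' (J ∘L U)) := by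
        rw [h𝒥, map_smul]
      _ = _ := congrArg _ (mfderiv_psi_vertical g g' hΨ J' (J ∘L U))
  -- Evaluation at `Q⁻¹X` makes the inner factors of `Q` cancel.
  have h2 : -ε • Q.symm (J (Q (Q.symm (U (Q (Q.symm X)))))) =
      ε • Q.symm (J (U (Q (Q.symm X)))) :=
    congrArg (fun ξ => fibreComponent (psi g g' J') ξ (Q.symm X)) h1
  simp only [ContinuousLinearEquiv.apply_symm_apply] at h2
  have h3 : Q.symm (J (U X)) = 0 := by
    rw [neg_smul, neg_eq_iff_add_eq_zero, ← two_smul ℝ, smul_smul] at h2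
    exact (smul_eq_zero.1 h2).resolve_left (mul_ne_zero two_ne_zero hε)
  have h4 : J (U X) = 0 := by simpa using h3
  have h5 := hJ.1.1 (U X)
  change J (J (U X)) = -U X at h5
  rw [h4, map_zero] at h5
  exact neg_eq_zero.1 h5.symm

end Manifold
end Twistor

theorem mainTheorem4 {m : ℕ} (hm : 2 ≤ m) {M : Type*} [TopologicalSpace M]
    [ChartedSpace (EuclideanSpace ℝ (Fin (2 * m))) M] [IsManifold (𝓡 (2 * m)) ∞ M] [Nonempty M]
    (o : Twistor.ManifoldOrientation m M) (g g' : Twistor.Metric m M) :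
    (¬ Twistor.IsHolomorphic g g' o (Twistor.atiyahHitchinSinger g) (Twistor.eellsSalamon g')
        (Twistor.psi g g') ∧
      ¬ Twistor.IsAntiHolomorphic g g' o (Twistor.atiyahHitchinSinger g) (Twistor.eellsSalamon g')
        (Twistor.psi g g')) ∧
    (¬ Twistor.IsHolomorphic g g' o (Twistor.eellsSalamon g) (Twistor.atiyahHitchinSinger g')
        (Twistor.psi g g') ∧
      ¬ Twistor.IsAntiHolomorphic g g' o (Twistor.eellsSalamon g) (Twistor.atiyahHitchinSinger g')
        (Twistor.psi g g')) := by
  open Twistor in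
  -- The sign is `ε = 1` when the source carries the Atiyah–Hitchin–Singer structure and `ε = -1`
  -- when it carries the Eells–Salamon one.
  exact ⟨⟨not_holomorphic_psi hm o g g' _ _ 1 one_ne_zero
        (fun J U => by rw [atiyahHitchinSinger_vertical, one_smul])
        (fun J U => by rw [eellsSalamon_vertical, neg_one_smul]),
      not_antiHolomorphic_psi hm o g g' _ _ (baseComponent_atiyahHitchinSinger g)
        (baseComponent_eellsSalamon g')⟩,
    not_holomorphic_psi hm o g g' _ _ (-1) (neg_ne_zero.2 one_ne_zero)
        (fun J U => by rw [eellsSalamon_vertical, neg_one_smul])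
        (fun J U => by rw [atiyahHitchinSinger_vertical, neg_neg, one_smul]),
      not_antiHolomorphic_psi hm o g g' _ _ (baseComponent_eellsSalamon g)
        (baseComponent_atiyahHitchinSinger g')⟩
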